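/- Let $p$ be a prime, let $E$ be a field of characteristic $p$ and let $\mathrm{B}\subset \mathrm{GL}_2(\mathbf{Q}_p)$ be the group of upper triangular matrices. Let $\mathrm{Z}$ be its centre (the matrices $a\cdot\mathrm{Id}$, $a\in\mathbf{Q}_p^\times$), let $\mathrm{K}\subset\mathrm{B}$ be the subgroup of upper triangular matrices with diagonal entries in $\mathbf{Z}_p^\times$ and upper right entry in $\mathbf{Z}_p$, and let $\mathrm{B}^+\subset\mathrm{B}$ be the monoid of matrices $\begin{pmatrix} a & b\\ 0& d\end{pmatrix}$ with $a\in \mathbf{Z}_p\setminus\{0\}$, $b\in\mathbf{Z}_p$, $d\in\mathbf{Z}_p^\times$. Let $\sigma_1,\sigma_2:\mathbf{Q}_p^\times\to E^\times$ be smooth characters, let $\sigma=\sigma_1\otimes\sigma_2:\mathrm{B}\to E^\times$ be the character $\begin{pmatrix} a & b\\ 0& d\end{pmatrix}\mapsto\sigma_1(a)\sigma_2(d)$, and let $E(\sigma)$ denote $E$ with $\mathrm{B}$ acting through $\sigma$. Let $\mathrm{ind}_{\mathrm{KZ}}^{\mathrm{B}}\sigma$ be the space of functions $f:\mathrm{B}\to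 E$ with compact support modulo $\mathrm{Z}$ such that $f(kg)=\sigma(k)f(g)$ for all $k\in\mathrm{KZ}$ and $g\in\mathrm{B}$, with the action of $\mathrm{B}$ given by $(gf)(h)=f(hg)$. For $g\in\mathrm{B}$ let $[g]\in\mathrm{ind}_{\mathrm{KZ}}^{\mathrm{B}}\sigma$ be the function with $[g](h)=\sigma(hg)$ if $h\in\mathrm{KZ}g^{-1}$ and $[g](h)=0$ otherwise. Let $(\mathrm{ind}_{\mathrm{KZ}}^{\mathrm{B}}\sigma)^+$ be the linear span of the functions $[g]$ with $g\in\mathrm{B}^+$; equivalently, it is the space of those $f\in \mathrm{ind}_{\mathrm{KZ}}^{\mathrm{B}}\sigma$ such that $f(h)\neq0$ implies $h^{-1}\in\mathrm{B}^+\mathrm{Z}$. Let $\Pi$ be a quotient of the representation $\mathrm{ind}_{\mathrm{KZ}}^{\mathrm{B}}\sigma$ of $\mathrm{B}$, and let $\Pi^+$ be the image of $(\mathrm{ind}_{\mathrm{KZ}}^{\mathrm{B}}\sigma)^+$ in $\Pi$. The operator $X=\begin{pmatrix}1&1\\0&1\end{pmatrix}-\mathrm{Id}$ preserves $\Pi^+$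 and is locally nilpotent on it, so that $\Pi^+$ is an $E[[X]]$-module. Theorem. If $\Pi$ has no quotient isomorphic to $E(\sigma)$, then the $E[[X]]$-module $\Pi^+$ is admissible: it is a torsion $E[[X]]$-module, and the $E$-vector space $\{v\in\Pi^+ : Xv=0\}$ is finite dimensional. -/

import Mathlib

open scoped Pointwise PowerSeries

noncomputable section

namespace BorelRep

/-! ### Power series acting through a locally nilpotent operator -/

section LocallyNilpotent

variable {E M : Type*} [Field E] [AddCommGroup M] [Module E M]

/-- An endomorphism `T` is locally nilpotent if every vector is killed by a power of `T`. -/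
def LocNilp (T : Module.End E M) : Prop := ∀ v : M, ∃ n : ℕ, (T ^ n) v = 0

/-- The finite sum `∑ i < n, aᵢ Tⁱ v`, where `f = ∑ aᵢ Xⁱ`. -/
def partialAct (T : Module.End E M) (n : ℕ) (f : E⟦X⟧) (v : M) : M :=
  ∑ i ∈ Finset.range n, PowerSeries.coeff i f • (T ^ i) v

theorem pow_eq_zero_of_le {T : Module.End E M} {v : M} {m n : ℕ} (h : (T ^ m) v = 0)
    (hmn : m ≤ n) : (T ^ n) v = 0 := by
  obtain ⟨k, rfl⟩ := Nat.exists_eq_add_of_le' hmn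
  rw [pow_add, Module.End.mul_apply, h, map_zero]

theorem partialAct_eq {T : Module.End E M} {v : M} {m n : ℕ} (h : (T ^ m) v = 0)
    (hmn : m ≤ n) (f : E⟦X⟧) : partialAct T n f v = partialAct T m f v := by
  unfold partialAct
  symm
  apply Finset.sum_subset (Finset.range_mono hmn)
  intro i _ hi
  rw [pow_eq_zero_of_le h (by simpa using hi), smul_zero]

theorem partialAct_eq' {T : Module.End E M} {v : M} {m n : ℕ} (hm : (T ^ m) v = 0)
    (hn : (T ^ n) v = 0) (f : E⟦X⟧) : partialAct T n f v = partialAct T m f v := by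
  rw [← partialAct_eq hm (le_max_left m n), ← partialAct_eq hn (le_max_right m n)]

/-- The action of `f = ∑ aᵢ Xⁱ` through a locally nilpotent operator `T`:
`f • v = ∑ aᵢ Tⁱ v`, a finite sum. -/
def act (T : Module.End E M) (hT : LocNilp T) (f : E⟦X⟧) (v : M) : M :=
  partialAct T (hT v).choose f v

theorem act_eq (T : Module.End E M) (hT : LocNilp T) (f : E⟦X⟧) {v : M} {n : ℕ}
    (hn : (T ^ n) v = 0) : act T hT f v = partialAct T n f v :=
  partialAct_eq' hn (hT v).choose_spec f

theorem pow_partialAct (T : Module.End E M) (k n : ℕ) (f : E⟦X⟧) (v : M) :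
    (T ^ k) (partialAct T n f v) = partialAct T n f ((T ^ k) v) := by
  simp only [partialAct, map_sum, map_smul, ← Module.End.mul_apply, ← pow_add, add_comm]

theorem partialAct_zero (T : Module.End E M) (n : ℕ) (f : E⟦X⟧) : partialAct T n f 0 = 0 := by
  simp [partialAct]

theorem partialAct_mul {T : Module.End E M} {n : ℕ} {v : M} (hn : (T ^ n) v = 0)
    (f g : E⟦X⟧) : partialAct T n (f * g) v = partialAct T n f (partialAct T n g v) := by
  have key : ∀ h : E⟦X⟧, ∀ w : M, partialAct T n h w
      = Polynomial.aeval T (PowerSeries.trunc n h) w := by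
    intro h w
    rw [Polynomial.aeval_def, PowerSeries.eval₂_trunc_eq_sum_range, LinearMap.sum_apply, partialAct]
    refine Finset.sum_congr rfl fun i _ => ?_
    simp [Module.algebraMap_end_apply]
  rw [key, key, key, ← Module.End.mul_apply, ← map_mul]
  have hdvd : (Polynomial.X : Polynomial E) ^ n ∣
      PowerSeries.trunc n f * PowerSeries.trunc n g - PowerSeries.trunc n (f * g) := by
    rw [Polynomial.X_pow_dvd_iff]
    intro d hd
    rw [← PowerSeries.trunc_trunc_mul_trunc, Polynomial.coeff_sub, PowerSeries.coeff_trunc,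
      if_pos hd, ← Polynomial.coe_mul, Polynomial.coeff_coe, sub_self]
  obtain ⟨r, hr⟩ := hdvd
  rw [← sub_eq_zero, ← LinearMap.sub_apply, ← map_sub, ← neg_sub, hr, mul_comm, map_neg, map_mul,
    map_pow, Polynomial.aeval_X, LinearMap.neg_apply, Module.End.mul_apply, hn, map_zero, neg_zero]

/-- The `E⟦X⟧`-module structure for which `X` acts as the locally nilpotent operator `T`. -/
abbrev powerSeriesModule (T : Module.End E M) (hT : LocNilp T) : Module E⟦X⟧ M where
  smul f v := act T hT f v
  one_smul v := by
    obtain ⟨n, hn⟩ := hT v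
    have hn' := pow_eq_zero_of_le hn n.le_succ
    change act T hT 1 v = v
    rw [act_eq T hT _ hn', partialAct, Finset.sum_range_succ']
    simp [PowerSeries.coeff_one]
  mul_smul f g v := by
    obtain ⟨n, hn⟩ := hT v
    change act T hT (f * g) v = act T hT f (act T hT g v)
    have h2 : (T ^ n) (partialAct T n g v) = 0 := by
      rw [pow_partialAct, hn, partialAct_zero]
    rw [act_eq T hT g hn, act_eq T hT _ hn, act_eq T hT f h2, partialAct_mul hn]
  smul_zero f := by
    change act T hT f 0 = 0
    rw [act_eq T hT f (n := 0) (by simp), partialAct_zero]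
  smul_add f v w := by
    change act T hT f (v + w) = act T hT f v + act T hT f w
    obtain ⟨m, hm⟩ := hT v
    obtain ⟨n, hn⟩ := hT w
    have h1 := pow_eq_zero_of_le hm (le_max_left m n)
    have h2 := pow_eq_zero_of_le hn (le_max_right m n)
    have h3 : (T ^ (max m n)) (v + w) = 0 := by rw [map_add, h1, h2, add_zero]
    rw [act_eq T hT f h1, act_eq T hT f h2, act_eq T hT f h3]
    simp [partialAct, Finset.sum_add_distrib]
  add_smul f g v := by
    change act T hT (f + g) v = act T hT f v + act T hT g v
    obtain ⟨n, hn⟩ := hT v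
    rw [act_eq T hT _ hn, act_eq T hT _ hn, act_eq T hT _ hn]
    simp [partialAct, Finset.sum_add_distrib, add_smul]
  zero_smul v := by
    change act T hT 0 v = 0
    obtain ⟨n, hn⟩ := hT v
    rw [act_eq T hT _ hn]
    simp [partialAct]

theorem act_smul_assoc (T : Module.End E M) (hT : LocNilp T) (c : E) (f : E⟦X⟧) (v : M) :
    act T hT (c • f) v = c • act T hT f v := by
  obtain ⟨n, hn⟩ := hT v
  rw [act_eq T hT _ hn, act_eq T hT _ hn]
  simp [partialAct, Finset.smul_sum, mul_smul]

theorem act_X (T : Module.End E M) (hT : LocNilp T) (v : M) :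
    act T hT PowerSeries.X v = T v := by
  obtain ⟨n, hn⟩ := hT v
  rw [act_eq T hT _ (pow_eq_zero_of_le hn (show n ≤ n + 2 by omega)), partialAct,
    Finset.sum_eq_single 1]
  · simp
  · intro i _ hi
    simp [PowerSeries.coeff_X, hi]
  · simp

end LocallyNilpotent

/-- An `E⟦X⟧`-module `M` is admissible if it is a torsion module and if the kernel of `X` on `M`
is a finite dimensional `E`-vector space. -/
def IsAdmissible (E M : Type*) [Field E] [AddCommGroup M] [Module E M] [Module E⟦X⟧ M]
    [IsScalarTower E E⟦X⟧ M] : Prop :=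
  Module.IsTorsion E⟦X⟧ M ∧
    FiniteDimensional E (Submodule.torsionBy E⟦X⟧ M (PowerSeries.X : E⟦X⟧))

/-! ### The Borel subgroup of `GL₂(ℚ_p)` -/

section Groups

variable (p : ℕ) [Fact p.Prime]

/-- The group `B = B₂(ℚ_p)` of upper triangular matrices in `GL₂(ℚ_p)`, with the subspace
topology. -/
def Borel : Subgroup (GL (Fin 2) ℚ_[p]) where
  carrier := {g | g 1 0 = 0}
  mul_mem' {g h} hg hh := by
    simp only [Set.mem_ofPred_eq] at hg hh ⊢
    simp [Matrix.mul_apply, Fin.sum_univ_two, hg, hh]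
  one_mem' := by simp
  inv_mem' {g} hg := by
    simp only [Set.mem_ofPred_eq] at hg ⊢
    simp [Matrix.inv_def, Matrix.adjugate_fin_two, hg]

variable {p}

/-- The upper left entry of an element of `B`. -/
def entryA (g : Borel p) : ℚ_[p] := (g : GL (Fin 2) ℚ_[p]) 0 0

/-- The upper right entry of an element of `B`. -/
def entryB (g : Borel p) : ℚ_[p] := (g : GL (Fin 2) ℚ_[p]) 0 1

/-- The lower right entry of an element of `B`. -/
def entryD (g : Borel p) : ℚ_[p] := (g : GL (Fin 2) ℚ_[p]) 1 1

theorem entry_zero (g : Borel p) : (g : GL (Fin 2) ℚ_[p]) 1 0 = 0 := g.2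

@[simp] theorem entryA_one : entryA (1 : Borel p) = 1 := by simp [entryA]

@[simp] theorem entryB_one : entryB (1 : Borel p) = 0 := by simp [entryB]

@[simp] theorem entryD_one : entryD (1 : Borel p) = 1 := by simp [entryD]

@[simp] theorem entryA_mul (g h : Borel p) : entryA (g * h) = entryA g * entryA h := by
  have := entry_zero h
  simp [entryA, Matrix.mul_apply, Fin.sum_univ_two, this]

@[simp] theorem entryB_mul (g h : Borel p) :
    entryB (g * h) = entryA g * entryB h + entryB g * entryD h := by
  simp [entryA, entryB, entryD, Matrix.mul_apply, Fin.sum_univ_two]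

@[simp] theorem entryD_mul (g h : Borel p) : entryD (g * h) = entryD g * entryD h := by
  have := entry_zero g
  simp [entryD, Matrix.mul_apply, Fin.sum_univ_two, this]

theorem entryA_ne_zero (g : Borel p) : entryA g ≠ 0 := fun h => by
  have := entryA_mul g g⁻¹
  simp [h] at this

theorem entryD_ne_zero (g : Borel p) : entryD g ≠ 0 := fun h => by
  have := entryD_mul g g⁻¹
  simp [h] at this

theorem borel_ext {g h : Borel p} (hA : entryA g = entryA h) (hB : entryB g = entryB h)
    (hD : entryD g = entryD h) : g = h := by
  apply Subtype.ext
  apply Matrix.GeneralLinearGroup.ext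
  intro i j
  fin_cases i <;> fin_cases j
  · exact hA
  · exact hB
  · exact (entry_zero g).trans (entry_zero h).symm
  · exact hD

variable (p)

/-- `K = B₂(ℤ_p)`: the diagonal entries lie in `ℤ_pˣ` and the upper right entry in `ℤ_p`. -/
def maxCompact : Set (Borel p) := {g | ‖entryA g‖ = 1 ∧ ‖entryB g‖ ≤ 1 ∧ ‖entryD g‖ = 1}

/-- The centre `Z` of `B`, consisting of the matrices `a · Id` with `a ∈ ℚ_pˣ`. -/
def scalars : Set (Borel p) := {g | entryA g = entryD g ∧ entryB g = 0}

/-- The monoid `B⁺`: the upper left entry lies in `p^n ℤ_pˣ` for some `n ≥ 0` (that is, it is a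
nonzero element of `ℤ_p`), the upper right one in `ℤ_p` and the lower right one in `ℤ_pˣ`. -/
def borelPlus : Set (Borel p) := {g | ‖entryA g‖ ≤ 1 ∧ ‖entryB g‖ ≤ 1 ∧ ‖entryD g‖ = 1}

/-- The unipotent matrix `u = (1 1; 0 1)`. -/
def unip : Borel p :=
  ⟨Matrix.GeneralLinearGroup.mkOfDetNeZero !![1, 1; 0, 1] (by simp), by
    simp [Borel, Matrix.GeneralLinearGroup.mkOfDetNeZero]⟩

@[simp] theorem entryA_unip : entryA (unip p) = 1 := by
  simp [entryA, unip, Matrix.GeneralLinearGroup.mkOfDetNeZero]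

@[simp] theorem entryB_unip : entryB (unip p) = 1 := by
  simp [entryB, unip, Matrix.GeneralLinearGroup.mkOfDetNeZero]

@[simp] theorem entryD_unip : entryD (unip p) = 1 := by
  simp [entryD, unip, Matrix.GeneralLinearGroup.mkOfDetNeZero]

end Groups

/-! ### The representation `ind_{KZ}^B σ` and its quotients -/

section Induction

variable {p : ℕ} [Fact p.Prime] {E : Type*} [Field E]

/-- The character `σ = σ₁ ⊗ σ₂` of `B`, given by `(a b; 0 d) ↦ σ₁(a) σ₂(d)`. -/
def tensorChar (σ₁ σ₂ : ℚ_[p]ˣ →* Eˣ) : Borel p →* Eˣ where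
  toFun g := σ₁ (Units.mk0 (entryA g) (entryA_ne_zero g)) *
    σ₂ (Units.mk0 (entryD g) (entryD_ne_zero g))
  map_one' := by simp
  map_mul' g h := by
    have hA : Units.mk0 (entryA (g * h)) (entryA_ne_zero _) =
        Units.mk0 (entryA g) (entryA_ne_zero g) * Units.mk0 (entryA h) (entryA_ne_zero h) := by
      ext; simp
    have hD : Units.mk0 (entryD (g * h)) (entryD_ne_zero _) =
        Units.mk0 (entryD g) (entryD_ne_zero g) * Units.mk0 (entryD h) (entryD_ne_zero h) := by
      ext; simp
    rw [hA, hD, map_mul, map_mul]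
    exact mul_mul_mul_comm _ _ _ _

/-- The one dimensional representation `E(σ)` of `B` attached to a character `σ`. -/
def charRep (σ : Borel p →* Eˣ) : Representation E (Borel p) E where
  toFun g := LinearMap.lsmul E E (σ g : E)
  map_one' := by ext; simp
  map_mul' g h := by ext; simp

/-- The space `ind_{KZ}^B σ` of functions `f : B → E` with `f(kg) = σ(k) f(g)` for `k ∈ KZ`,
having compact support modulo `Z` (the support is contained in `C Z` for some compact `C`). -/
def ind (σ : Borel p →* Eˣ) : Submodule E (Borel p → E) where
  carrier := {f | (∀ k ∈ maxCompact p * scalars p, ∀ g, f (k * g) = (σ k : E) * f g) ∧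
    ∃ C : Set (Borel p), IsCompact C ∧ Function.support f ⊆ C * scalars p}
  add_mem' := by
    rintro f g ⟨hf, C, hC, hfC⟩ ⟨hg, D, hD, hgD⟩
    refine ⟨fun k hk x => by simp [hf k hk, hg k hk, mul_add], C ∪ D, hC.union hD, ?_⟩
    rw [Set.union_mul]
    exact (Function.support_add f g).trans (Set.union_subset_union hfC hgD)
  zero_mem' := ⟨by simp, ∅, isCompact_empty, by simp⟩
  smul_mem' := by
    rintro c f ⟨hf, C, hC, hfC⟩
    refine ⟨fun k hk x => by simp [hf k hk, mul_left_comm], C, hC, ?_⟩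
    exact (Function.support_const_smul_subset c f).trans hfC

theorem scalars_comm {z : Borel p} (hz : z ∈ scalars p) (g : Borel p) : z * g = g * z := by
  obtain ⟨h1, h2⟩ := hz
  apply borel_ext <;> simp [h1, h2, mul_comm]

/-- The action of `B` on `ind_{KZ}^B σ`, given by `(g f)(h) = f(hg)`. -/
def indRep (σ : Borel p →* Eˣ) : Representation E (Borel p) (ind σ) where
  toFun g := (LinearMap.funLeft E E (fun h : Borel p => h * g)).restrict (by
    rintro f ⟨hf, C, hC, hfC⟩
    refine ⟨fun k hk x => by simp [LinearMap.funLeft_apply, mul_assoc, hf k hk],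
      (fun c => c * g⁻¹) '' C, hC.image (continuous_mul_const g⁻¹), ?_⟩
    intro h hh
    obtain ⟨c, hc, z, hz, hcz⟩ := hfC (show f (h * g) ≠ 0 from hh)
    refine ⟨c * g⁻¹, ⟨c, hc, rfl⟩, z, hz, ?_⟩
    change c * z = h * g at hcz
    change c * g⁻¹ * z = h
    rw [mul_assoc, ← scalars_comm hz, ← mul_assoc, hcz, mul_inv_cancel_right])
  map_one' := by ext f h; simp [LinearMap.funLeft_apply]
  map_mul' g₁ g₂ := by ext f h; simp [LinearMap.funLeft_apply, mul_assoc]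

@[simp] theorem indRep_apply (σ : Borel p →* Eˣ) (g : Borel p) (f : ind σ) (h : Borel p) :
    (indRep σ g f : Borel p → E) h = (f : Borel p → E) (h * g) := rfl

/-- The subspace `(ind_{KZ}^B σ)⁺`. The basic function `[g] : h ↦ σ(hg)` lives on `KZ g⁻¹`, and
`[gk] = σ(k) [g]` for `k ∈ KZ`; a function is said to be supported on `B⁺` when it is a linear
combination of functions `[g]` with `g ∈ B⁺`, in other words when it vanishes at every `h` with
`h⁻¹ ∉ B⁺ Z`. -/
def indPlus (σ : Borel p →* Eˣ) : Submodule E (ind σ) where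
  carrier := {f | ∀ h, (f : Borel p → E) h ≠ 0 → h⁻¹ ∈ borelPlus p * scalars p}
  add_mem' := by
    intro f g hf hg h hh
    by_cases h0 : (f : Borel p → E) h = 0
    · exact hg h fun h1 => hh (by simp [h0, h1])
    · exact hf h h0
  zero_mem' := by intro h hh; simp at hh
  smul_mem' := by
    intro c f hf h hh
    exact hf h fun h1 => hh (by simp [h1])

variable {V : Type*} [AddCommGroup V] [Module E V] {ρ : Representation E (Borel p) V}
  {σ : Borel p →* Eˣ}

/-- The image `Π⁺` of `(ind_{KZ}^B σ)⁺` under an equivariant map `ind_{KZ}^B σ → Π`. -/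
def piPlus (q : (indRep σ).IntertwiningMap ρ) : Submodule E V :=
  (indPlus σ).map q.toLinearMap

theorem indPlus_unip {f : ind σ} (hf : f ∈ indPlus σ) : indRep σ (unip p) f ∈ indPlus σ := by
  intro h hh
  obtain ⟨b, ⟨h1, h2, h3⟩, z, hz, hbz⟩ := hf (h * unip p) hh
  change b * z = (h * unip p)⁻¹ at hbz
  refine ⟨unip p * b, ⟨by simpa using h1, ?_, by simpa using h3⟩, z, hz, ?_⟩
  · simp only [entryB_mul, entryA_unip, entryB_unip, one_mul]
    exact (Padic.nonarchimedean _ _).trans (max_le h2 h3.le)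
  · change unip p * b * z = h⁻¹
    rw [mul_assoc, hbz]
    group

/-- The operator `X = (1 1; 0 1) - Id` on `Π⁺`. -/
def opX (q : (indRep σ).IntertwiningMap ρ) : Module.End E (piPlus q) :=
  (ρ (unip p) - 1).restrict (by
    rintro _ ⟨f, hf, rfl⟩
    refine ⟨indRep σ (unip p) f - f, Submodule.sub_mem _ (indPlus_unip hf) hf, ?_⟩
    rw [map_sub]
    simp [q.isIntertwining])

theorem entryA_unip_pow (n : ℕ) : entryA (unip p ^ n) = 1 := by
  induction n with
  | zero => simp
  | succ n ih => simp [pow_succ, ih]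

theorem entryD_unip_pow (n : ℕ) : entryD (unip p ^ n) = 1 := by
  induction n with
  | zero => simp
  | succ n ih => simp [pow_succ, ih]

theorem entryB_unip_pow (n : ℕ) : entryB (unip p ^ n) = n := by
  induction n with
  | zero => simp
  | succ n ih => simp [pow_succ, ih, entryA_unip_pow, add_comm]

theorem continuous_entryA : Continuous (entryA (p := p)) :=
  (Units.continuous_val.comp continuous_subtype_val).matrix_elem 0 0

theorem continuous_entryD : Continuous (entryD (p := p)) :=
  (Units.continuous_val.comp continuous_subtype_val).matrix_elem 1 1

theorem conj_unip_pow (g : Borel p) (n : ℕ)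
    (h : ‖entryA g‖ * ‖(p : ℚ_[p])‖ ^ n ≤ ‖entryD g‖) :
    g * unip p ^ p ^ n * g⁻¹ ∈ maxCompact p * scalars p ∧
      ∀ σ₁ σ₂ : ℚ_[p]ˣ →* Eˣ, tensorChar σ₁ σ₂ (g * unip p ^ p ^ n * g⁻¹) = 1 := by
  set w := g * unip p ^ p ^ n * g⁻¹ with hw
  have hwg : w * g = g * unip p ^ p ^ n := by rw [hw, inv_mul_cancel_right]
  have hA : entryA w = 1 := by
    have := congrArg entryA hwg
    rw [entryA_mul w g, entryA_mul g, entryA_unip_pow, mul_one] at this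
    exact (mul_eq_right₀ (entryA_ne_zero g)).mp this
  have hD : entryD w = 1 := by
    have := congrArg entryD hwg
    rw [entryD_mul w g, entryD_mul g, entryD_unip_pow, mul_one] at this
    exact (mul_eq_right₀ (entryD_ne_zero g)).mp this
  have hB : entryB w * entryD g = entryA g * (p : ℚ_[p]) ^ n := by
    have := congrArg entryB hwg
    rw [entryB_mul w g, entryB_mul g, entryB_unip_pow, entryD_unip_pow, hA] at this
    push_cast at this
    linear_combination this
  have hd : 0 < ‖entryD g‖ := norm_pos_iff.mpr (entryD_ne_zero g)
  refine ⟨Set.mem_mul.mpr ⟨w, ⟨by simp [hA], ?_, by simp [hD]⟩, 1, ⟨by simp, by simp⟩,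
    mul_one w⟩, fun σ₁ σ₂ => ?_⟩
  · have h1 := congrArg norm hB
    rw [norm_mul, norm_mul, norm_pow] at h1
    rw [← h1] at h
    exact le_of_mul_le_mul_right (by simpa using h) hd
  · have h1 : Units.mk0 (entryA w) (entryA_ne_zero w) = 1 := by ext; simp [hA]
    have h2 : Units.mk0 (entryD w) (entryD_ne_zero w) = 1 := by ext; simp [hD]
    change σ₁ (Units.mk0 (entryA w) (entryA_ne_zero w)) *
      σ₂ (Units.mk0 (entryD w) (entryD_ne_zero w)) = 1
    rw [h1, h2, map_one, map_one, one_mul]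

/-- Every element of `ind_{KZ}^B σ` is fixed by `u ^ (p ^ n)` for large `n`. -/
theorem exists_unip_pow_fix (σ₁ σ₂ : ℚ_[p]ˣ →* Eˣ) (f : ind (tensorChar σ₁ σ₂)) :
    ∃ n : ℕ, indRep (tensorChar σ₁ σ₂) (unip p ^ p ^ n) f = f := by
  obtain ⟨f, hf, C, hC, hfC⟩ := f
  have hcont : ContinuousOn (fun g : Borel p => entryA g * (entryD g)⁻¹) C :=
    (continuous_entryA.mul (continuous_entryD.inv₀ entryD_ne_zero)).continuousOn
  obtain ⟨M, hM⟩ := hC.exists_bound_of_continuousOn hcont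
  obtain ⟨n, hn⟩ := exists_pow_lt_of_lt_one (show (0 : ℝ) < (max M 1)⁻¹ by positivity)
    (Padic.norm_p_lt_one (p := p))
  have hn1 : max M 1 * ‖(p : ℚ_[p])‖ ^ n ≤ 1 := by
    have h0 : (0 : ℝ) < max M 1 := by positivity
    calc max M 1 * ‖(p : ℚ_[p])‖ ^ n ≤ max M 1 * (max M 1)⁻¹ := by gcongr
      _ = 1 := mul_inv_cancel₀ h0.ne'
  have key : ∀ h ∈ C * scalars p, ‖entryA h‖ * ‖(p : ℚ_[p])‖ ^ n ≤ ‖entryD h‖ := by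
    rintro _ ⟨c, hc, z, ⟨hz, -⟩, rfl⟩
    have h1 := (hM c hc).trans (le_max_left M 1)
    have hd : 0 < ‖entryD c‖ := norm_pos_iff.mpr (entryD_ne_zero c)
    rw [norm_mul, norm_inv, ← div_eq_mul_inv, div_le_iff₀ hd] at h1
    simp only [entryA_mul, entryD_mul, norm_mul, hz]
    calc ‖entryA c‖ * ‖entryD z‖ * ‖(p : ℚ_[p])‖ ^ n
        ≤ max M 1 * ‖entryD c‖ * ‖entryD z‖ * ‖(p : ℚ_[p])‖ ^ n := by gcongr
      _ = (max M 1 * ‖(p : ℚ_[p])‖ ^ n) * (‖entryD c‖ * ‖entryD z‖) := by ring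
      _ ≤ 1 * (‖entryD c‖ * ‖entryD z‖) := by gcongr
      _ = _ := one_mul _
  refine ⟨n, Subtype.ext (funext fun h => ?_)⟩
  rw [indRep_apply]
  change f (h * unip p ^ p ^ n) = f h
  by_cases hh : ‖entryA h‖ * ‖(p : ℚ_[p])‖ ^ n ≤ ‖entryD h‖
  · obtain ⟨h1, h2⟩ := conj_unip_pow (E := E) h n hh
    have h3 := hf _ h1 h
    rw [inv_mul_cancel_right, h2, Units.val_one, one_mul] at h3
    exact h3
  · have h1 : f h = 0 := by
      by_contra h0
      exact hh (key h (hfC h0))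
    have h2 : f (h * unip p ^ p ^ n) = 0 := by
      by_contra h0
      have := key _ (hfC h0)
      rw [entryA_mul, entryD_mul, entryA_unip_pow, entryD_unip_pow, mul_one, mul_one] at this
      exact hh this
    rw [h1, h2]

variable {σ₁ σ₂ : ℚ_[p]ˣ →* Eˣ}

theorem locNilp_opX [CharP E p] (q : (indRep (tensorChar σ₁ σ₂)).IntertwiningMap ρ) :
    LocNilp (opX q) := by
  rintro ⟨_, f, hf, rfl⟩
  obtain ⟨n, hn⟩ := exists_unip_pow_fix σ₁ σ₂ f
  refine ⟨p ^ n, Subtype.ext ?_⟩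
  have hpow : (ρ (unip p) - 1) ^ p ^ n = ρ (unip p ^ p ^ n) - 1 := by
    have h1 := congrArg (Polynomial.aeval (ρ (unip p)))
      (sub_pow_char_pow (R := Polynomial E) (p := p) (n := n) Polynomial.X 1)
    simpa using h1
  rw [opX, Module.End.pow_restrict, LinearMap.coe_restrict_apply]
  simp only [hpow]
  change ρ (unip p ^ p ^ n) (q f) - q f = 0
  rw [← q.isIntertwining, hn, sub_self]

/-- The `E⟦X⟧`-module structure on `Π⁺`, where `X` acts as `(1 1; 0 1) - Id`. -/
instance piPlusModule [CharP E p] (q : (indRep (tensorChar σ₁ σ₂)).IntertwiningMap ρ) :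
    Module E⟦X⟧ (piPlus q) :=
  powerSeriesModule (opX q) (locNilp_opX q)

theorem piPlus_X_smul [CharP E p] (q : (indRep (tensorChar σ₁ σ₂)).IntertwiningMap ρ)
    (v : piPlus q) :
    (((PowerSeries.X : E⟦X⟧) • v : piPlus q) : V) = ρ (unip p) (v : V) - (v : V) := by
  change ((act (opX q) (locNilp_opX q) PowerSeries.X v : piPlus q) : V) = _
  rw [act_X]
  rfl

instance piPlusTower [CharP E p] (q : (indRep (tensorChar σ₁ σ₂)).IntertwiningMap ρ) :
    IsScalarTower E E⟦X⟧ (piPlus q) :=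
  ⟨fun c f v => act_smul_assoc (opX q) (locNilp_opX q) c f v⟩

end Induction

end BorelRep

end

noncomputable section

namespace BorelRep

/-! ### Linear algebra of a pair of operators with `F * U = U ^ p * F` -/

section TwistedModule

variable {E M : Type*} [Field E] [AddCommGroup M] [Module E M]

/-! Let v be the image of [1] in Π, and let U and F be the actions of u = (1 1; 0 1) and diag(p, 1).
Then Uv = v, FU = U^p F, and Π⁺ is contained in the span of the vectors U^b F^n v (`piPlus_le`).
Torsion is immediate from local nilpotence, so the point is the kernel of X = U - 1.

The hypothesis on Π enters through the augmentation f ↦ ∑ f(g⁻¹) σ(g) from the induced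
representation onto E(σ). It cannot factor through Π, so some f dies in Π while its augmentation is
nonzero (`exists_augmentation_ne_zero`). Translating f by a high power of diag(p, 1) moves it into
the positive part and gives a relation ∑ cᵢ U^{bᵢ} F^{nᵢ} v = 0. Since σ(u) = 1, the polynomial A =
∑ cᵢ T^{nᵢ} evaluated at σ(diag(p, 1)) is a unit times the augmentation of f, so A ≠ 0.

Let W_l be the finite dimensional span of the U^b F^k v with k ≤ l. By rank-nullity the kernel of U
- 1 on W_l is at most as large as a space L that spans W_l modulo (U - 1)W_l. Modulo that image the
powers of U disappear: the F^j v with j ≤ l suffice, and the relation says that A(F) F^k v vanishes,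
as long as no vector involved leaves W_l. All F^j v are thus reduced to deg A low powers and
boundedly many top ones. The bound does not depend on l, so the kernel on the union of the W_l is
finite dimensional (`finiteDimensional_ker_inf_iSup_levelSpan`). -/

theorem finrank_ker_inf_le (T : Module.End E M) (W L : Submodule E M) [FiniteDimensional E W]
    [FiniteDimensional E L] (hW : W ≤ L ⊔ W.map T) :
    Module.finrank E (LinearMap.ker T ⊓ W : Submodule E M) ≤ Module.finrank E L := by
  -- Rank-nullity for `T` restricted to `W`; the image of `W` need not lie in `W`.
  have h1 := LinearMap.finrank_range_add_finrank_ker (T.domRestrict W)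
  rw [LinearMap.range_domRestrict, LinearMap.ker_domRestrict] at h1
  have h2 : Module.finrank E ((LinearMap.ker T).comap W.subtype) =
      Module.finrank E (LinearMap.ker T ⊓ W : Submodule E M) := by
    rw [inf_comm, ← Submodule.map_comap_subtype]
    exact (Submodule.finrank_map_subtype_eq W _).symm
  have h3 := (Submodule.finrank_mono hW).trans (Submodule.finrank_add_le_finrank_add_finrank _ _)
  omega

/-- A term of maximal dimension equals every later one, so the chain is stationary. -/
theorem finiteDimensional_iSup_of_finrank_le {S : ℕ → Submodule E M} (hS : Monotone S)
    [∀ n, FiniteDimensional E (S n)] {d : ℕ} (hd : ∀ n, Module.finrank E (S n) ≤ d) :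
    FiniteDimensional E (⨆ n, S n : Submodule E M) := by
  obtain ⟨n, hn⟩ : ∃ n, ∀ k, Module.finrank E (S k) ≤ Module.finrank E (S n) := by
    have hfin : (Set.range fun n => Module.finrank E (S n)).Finite :=
      (Set.finite_Iic d).subset (by rintro _ ⟨n, rfl⟩; exact hd n)
    obtain ⟨_, ⟨n, rfl⟩, hn⟩ := Set.exists_max_image _ id hfin ⟨_, 0, rfl⟩
    exact ⟨n, fun k => hn _ ⟨k, rfl⟩⟩
  have h : (⨆ n, S n) = S n := by
    refine le_antisymm (iSup_le fun k => ?_) (le_iSup S n)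
    rw [Submodule.eq_of_le_of_finrank_le (hS (le_max_left n k)) (hn _)]
    exact hS (le_max_right n k)
  rw [h]
  infer_instance

variable (U F : Module.End E M) (v : M)

/-- The span of the vectors `U ^ b (F ^ k v)` with `k ≤ n`. -/
def levelSpan (n : ℕ) : Submodule E M :=
  Submodule.span E {x | ∃ b k : ℕ, k ≤ n ∧ x = (U ^ b) ((F ^ k) v)}

variable {U F v}

theorem mem_levelSpan {b k n : ℕ} (h : k ≤ n) : (U ^ b) ((F ^ k) v) ∈ levelSpan U F v n :=
  Submodule.subset_span ⟨b, k, h, rfl⟩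

theorem levelSpan_mono : Monotone (levelSpan U F v) := fun _ _ h =>
  Submodule.span_mono fun _ ⟨b, k, hk, hx⟩ => ⟨b, k, le_trans hk h, hx⟩

/-- Each `U ^ b - 1` has image in that of `U - 1` on `levelSpan`. -/
theorem pow_sub_mem_map {b k n : ℕ} (h : k ≤ n) :
    (U ^ b) ((F ^ k) v) - (F ^ k) v ∈ (levelSpan U F v n).map (U - 1) := by
  induction b with
  | zero => simp
  | succ b ih =>
    have : (U ^ (b + 1)) ((F ^ k) v) - (F ^ k) v =
        (U - 1) ((U ^ b) ((F ^ k) v)) + ((U ^ b) ((F ^ k) v) - (F ^ k) v) := by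
      simp [pow_succ']
    rw [this]
    exact add_mem (Submodule.mem_map_of_mem (mem_levelSpan h)) ih

variable {p : ℕ}

theorem pow_mul_pow_comm (hFU : F * U = U ^ p * F) (k b : ℕ) :
    F ^ k * U ^ b = U ^ (b * p ^ k) * F ^ k := by
  have h1 : ∀ b, F * U ^ b = U ^ (b * p) * F := by
    intro b
    induction b with
    | zero => simp
    | succ b ih => rw [pow_succ, ← mul_assoc, ih, mul_assoc, hFU, ← mul_assoc, ← pow_add]; ring_nf
  induction k generalizing b with
  | zero => simp
  | succ k ih => rw [pow_succ, mul_assoc, h1, ← mul_assoc, ih, mul_assoc]; ring_nf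

theorem pow_mul_pow_apply (hFU : F * U = U ^ p * F) (k b : ℕ) (w : M) :
    (F ^ k) ((U ^ b) w) = (U ^ (b * p ^ k)) ((F ^ k) w) :=
  LinearMap.congr_fun (pow_mul_pow_comm hFU k b) w

/-- Moving `F ^ k` past `U` shows that `U ^ p ^ k` fixes `F ^ k v`, so only `b` modulo `p ^ k`
matters. -/
theorem finiteDimensional_levelSpan (hp : 0 < p) (hFU : F * U = U ^ p * F) (hv : U v = v)
    (n : ℕ) : FiniteDimensional E (levelSpan U F v n) := by
  refine FiniteDimensional.span_of_finite E (((Set.finite_Iio (p ^ n)).prod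
    (Set.finite_Iic n)).image (fun x => (U ^ x.1) ((F ^ x.2) v)) |>.subset ?_)
  rintro _ ⟨b, k, hk, rfl⟩
  have hfix : (U ^ p ^ k) ((F ^ k) v) = (F ^ k) v := by
    rw [← one_mul (p ^ k), ← pow_mul_pow_apply hFU, pow_one, hv]
  have hfix' : ∀ j, (U ^ (p ^ k * j)) ((F ^ k) v) = (F ^ k) v := by
    intro j
    induction j with
    | zero => simp
    | succ j ih => rw [Nat.mul_succ, pow_add, Module.End.mul_apply, hfix, ih]
  refine ⟨(b % p ^ k, k), ⟨?_, hk⟩, ?_⟩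
  · exact (Nat.mod_lt _ (pow_pos hp k)).trans_le (Nat.pow_le_pow_right hp hk)
  · conv_rhs => rw [← Nat.mod_add_div b (p ^ k), pow_add, Module.End.mul_apply, hfix']

/-- A relation `∑ cᵢ U ^ bᵢ F ^ nᵢ v = 0` for which `∑ cᵢ X ^ nᵢ` is a nonzero polynomial makes
the kernel of `U - 1` finite dimensional on the span of the vectors `U ^ b F ^ n v`. -/
theorem finiteDimensional_ker_inf_iSup_levelSpan (hp : 0 < p) (hFU : F * U = U ^ p * F)
    (hv : U v = v) {ι : Type*} (s : Finset ι) (c : ι → E) (b n : ι → ℕ)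
    (hrel : ∑ i ∈ s, c i • (U ^ b i) ((F ^ n i) v) = 0)
    (hne : ∑ i ∈ s, Polynomial.monomial (n i) (c i) ≠ 0) :
    FiniteDimensional E
      (LinearMap.ker (U - 1) ⊓ ⨆ k, levelSpan U F v k : Submodule E M) := by
  have hfd := finiteDimensional_levelSpan hp hFU hv
  set A := ∑ i ∈ s, Polynomial.monomial (n i) (c i) with hA
  set m := A.natDegree
  set N := s.sup n
  -- Apply `F ^ k` to the relation and replace each power of `U` by 1, at the cost of an element of
  -- the image of `U - 1`. As `N` bounds the `n i`, the condition `k + N ≤ l` keeps every vector in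
  -- level `l`.
  have hrel' : ∀ k l, k + N ≤ l →
      Polynomial.aeval F A ((F ^ k) v) ∈ (levelSpan U F v l).map (U - 1) := by
    intro k l hkl
    have h0 := congrArg (F ^ k) hrel
    simp only [map_sum, map_smul, map_zero, pow_mul_pow_apply hFU] at h0
    have h1 : Polynomial.aeval F A ((F ^ k) v) = -∑ i ∈ s, c i •
        ((U ^ (b i * p ^ k)) ((F ^ (k + n i)) v) - (F ^ (k + n i)) v) := by
      simp only [smul_sub, Finset.sum_sub_distrib, pow_add, Module.End.mul_apply] at h0 ⊢
      rw [h0, hA, zero_sub, neg_neg, map_sum, LinearMap.sum_apply]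
      refine Finset.sum_congr rfl fun i _ => ?_
      rw [Polynomial.aeval_monomial, ← Algebra.smul_def, LinearMap.smul_apply,
        ← Module.End.mul_apply, ← Module.End.mul_apply, ← pow_add, ← pow_add, add_comm]
    rw [h1]
    refine neg_mem (Submodule.sum_mem _ fun i hi => Submodule.smul_mem _ _ (pow_sub_mem_map ?_))
    have := Finset.le_sup (f := n) hi
    omega
  rw [levelSpan_mono.directed_le.inf_iSup_eq]
  have hfd' : ∀ l, FiniteDimensional E
      (LinearMap.ker (U - 1) ⊓ levelSpan U F v l : Submodule E M) :=
    fun l => Submodule.finiteDimensional_of_le inf_le_right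
  refine finiteDimensional_iSup_of_finrank_le (d := m + N)
    (fun _ _ h => inf_le_inf_left _ (levelSpan_mono h)) fun l => ?_
  -- Exponents that the relation cannot lower: those below the degree of `A`, and the last `N` up to
  -- `l`, where the relation could leave level `l`. If `N > l + 1`, the truncated subtraction gives
  -- all exponents up to `l`, still at most `N` of them.
  set e : Finset ℕ := Finset.range m ∪ Finset.Ico (l + 1 - N) (l + 1)
  set L := Submodule.span E ((fun j => (F ^ j) v) '' (e : Set ℕ))
  have hLfd : FiniteDimensional E L := FiniteDimensional.span_of_finite E (e.finite_toSet.image _)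
  have hL : Module.finrank E L ≤ m + N := by
    classical
    rw [show L = Submodule.span E (e.image (fun j => (F ^ j) v) : Set M) by simp [L]]
    refine (finrank_span_finset_le_card _).trans (Finset.card_image_le.trans
      ((Finset.card_union_le _ _).trans ?_))
    simp only [Finset.card_range, Nat.card_Ico]
    omega
  refine (finrank_ker_inf_le (U - 1) (levelSpan U F v l) L (Submodule.span_le.mpr ?_)).trans hL
  have hpow : ∀ j ≤ l, (F ^ j) v ∈ L ⊔ (levelSpan U F v l).map (U - 1) := by
    intro j
    induction j using Nat.strong_induction_on with
    | _ j ih =>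
      intro hj
      by_cases hje : j ∈ e
      · exact Submodule.mem_sup_left (Submodule.subset_span ⟨j, hje, rfl⟩)
      simp only [e, Finset.mem_union, Finset.mem_range, Finset.mem_Ico, not_or] at hje
      obtain ⟨k, rfl⟩ : ∃ k, j = m + k := ⟨j - m, by omega⟩
      -- The leading coefficient of `A` is invertible, so this expresses `F ^ (m + k) v` through
      -- lower powers, modulo the image of `U - 1`.
      have h := hrel' k l (by omega)
      rw [Polynomial.aeval_eq_sum_range, LinearMap.sum_apply, Finset.sum_range_succ] at h
      have h1 : ∑ i ∈ Finset.range m, (A.coeff i • F ^ i) ((F ^ k) v) ∈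
          L ⊔ (levelSpan U F v l).map (U - 1) := by
        refine Submodule.sum_mem _ fun i hi => ?_
        rw [LinearMap.smul_apply, ← Module.End.mul_apply, ← pow_add]
        rw [Finset.mem_range] at hi
        exact Submodule.smul_mem _ _ (ih _ (by omega) (by omega))
      have h2 := (Submodule.add_mem_iff_right _ h1).mp (Submodule.mem_sup_right h)
      rw [LinearMap.smul_apply, ← Module.End.mul_apply, ← pow_add] at h2
      exact (Submodule.smul_mem_iff _ (Polynomial.leadingCoeff_ne_zero.mpr hne)).mp h2
  rintro _ ⟨b, k, hk, rfl⟩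
  rw [← sub_add_cancel ((U ^ b) ((F ^ k) v)) ((F ^ k) v)]
  exact add_mem (Submodule.mem_sup_right (pow_sub_mem_map hk)) (hpow k hk)

end TwistedModule


/-! ### The group `KZ`, the monoid `B⁺Z` and their cosets -/

section Cosets

variable {p : ℕ} [Fact p.Prime]

/-- The matrix `(a b; 0 d)`. -/
def borelMk (a d : ℚ_[p]ˣ) (b : ℚ_[p]) : Borel p :=
  ⟨⟨!![(a : ℚ_[p]), b; 0, d], !![((a⁻¹ : ℚ_[p]ˣ) : ℚ_[p]), -((a⁻¹ : ℚ_[p]ˣ) * b * (d⁻¹ : ℚ_[p]ˣ));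
    0, ((d⁻¹ : ℚ_[p]ˣ) : ℚ_[p])], by
      ext i j; fin_cases i <;> fin_cases j <;> simp
      field_simp
      ring,
    by ext i j; fin_cases i <;> fin_cases j <;> simp⟩, by simp [Borel]⟩

@[simp] theorem entryA_borelMk (a d : ℚ_[p]ˣ) (b : ℚ_[p]) : entryA (borelMk a d b) = a := by
  simp [entryA, borelMk]

@[simp] theorem entryB_borelMk (a d : ℚ_[p]ˣ) (b : ℚ_[p]) : entryB (borelMk a d b) = b := by
  simp [entryB, borelMk]

@[simp] theorem entryD_borelMk (a d : ℚ_[p]ˣ) (b : ℚ_[p]) : entryD (borelMk a d b) = d := by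
  simp [entryD, borelMk]

theorem continuous_borelMk :
    Continuous fun x : (ℚ_[p]ˣ × ℚ_[p]ˣ) × ℚ_[p] => borelMk x.1.1 x.1.2 x.2 := by
  refine Continuous.subtype_mk (Units.continuous_iff.mpr ⟨?_, ?_⟩) _
  · refine continuous_matrix fun i j => ?_
    fin_cases i <;> fin_cases j
    · exact Units.continuous_val.comp (continuous_fst.comp continuous_fst)
    · exact continuous_snd
    · exact continuous_const
    · exact Units.continuous_val.comp (continuous_snd.comp continuous_fst)
  · have h1 : Continuous fun x : (ℚ_[p]ˣ × ℚ_[p]ˣ) × ℚ_[p] => ((x.1.1⁻¹ : ℚ_[p]ˣ) : ℚ_[p]) :=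
      Units.continuous_val.comp (continuous_inv.comp (continuous_fst.comp continuous_fst))
    have h2 : Continuous fun x : (ℚ_[p]ˣ × ℚ_[p]ˣ) × ℚ_[p] => ((x.1.2⁻¹ : ℚ_[p]ˣ) : ℚ_[p]) :=
      Units.continuous_val.comp (continuous_inv.comp (continuous_snd.comp continuous_fst))
    refine continuous_matrix fun i j => ?_
    fin_cases i <;> fin_cases j
    · exact h1
    · exact ((h1.mul continuous_snd).mul h2).neg
    · exact continuous_const
    · exact h2

theorem continuous_entryB : Continuous (entryB (p := p)) :=
  (Units.continuous_val.comp continuous_subtype_val).matrix_elem 0 1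

theorem entryA_inv (g : Borel p) : entryA g⁻¹ = (entryA g)⁻¹ :=
  eq_inv_of_mul_eq_one_left (by rw [← entryA_mul, inv_mul_cancel, entryA_one])

theorem entryD_inv (g : Borel p) : entryD g⁻¹ = (entryD g)⁻¹ :=
  eq_inv_of_mul_eq_one_left (by rw [← entryD_mul, inv_mul_cancel, entryD_one])

theorem entryB_inv (g : Borel p) : entryB g⁻¹ = -(entryB g / (entryA g * entryD g)) := by
  have h := entryB_mul g g⁻¹
  have hA := entryA_ne_zero g
  have hD := entryD_ne_zero g
  rw [mul_inv_cancel, entryB_one, entryD_inv] at h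
  field_simp at h ⊢
  linear_combination -h

variable (p) in
/-- The subgroup `KZ`. -/
def compactCenter : Subgroup (Borel p) where
  carrier := {g | ‖entryA g‖ = ‖entryD g‖ ∧ ‖entryB g‖ ≤ ‖entryD g‖}
  one_mem' := by simp
  mul_mem' := by
    rintro g h ⟨hg1, hg2⟩ ⟨hh1, hh2⟩
    refine ⟨by simp [hg1, hh1], ?_⟩
    rw [entryB_mul, entryD_mul, norm_mul]
    refine (Padic.nonarchimedean _ _).trans (max_le ?_ ?_)
    · rw [norm_mul, hg1]; gcongr
    · rw [norm_mul]; gcongr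
  inv_mem' := by
    rintro g ⟨h1, h2⟩
    have hd : 0 < ‖entryD g‖ := norm_pos_iff.mpr (entryD_ne_zero g)
    refine ⟨by simp [entryA_inv, entryD_inv, h1], ?_⟩
    rw [entryB_inv, entryD_inv, norm_neg, norm_div, norm_mul, h1, norm_inv, div_le_iff₀ (by positivity)]
    field_simp
    exact h2

theorem mem_compactCenter {g : Borel p} :
    g ∈ compactCenter p ↔ ‖entryA g‖ = ‖entryD g‖ ∧ ‖entryB g‖ ≤ ‖entryD g‖ := Iff.rfl

/-- Normalising the lower right entry to 1 by a scalar turns membership in `KZ` and in `B⁺Z` into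
inequalities between norms of entries. -/
theorem exists_mul_scalar (g : Borel p) :
    ∃ k, ∃ z ∈ scalars p, k * z = g ∧ entryA k = entryA g / entryD g ∧
      entryB k = entryB g / entryD g ∧ entryD k = 1 := by
  have hD := entryD_ne_zero g
  refine ⟨borelMk (Units.mk0 _ (entryA_ne_zero g) / Units.mk0 _ hD) 1 (entryB g / entryD g),
    borelMk (Units.mk0 _ hD) (Units.mk0 _ hD) 0, ⟨by simp, by simp⟩, ?_, by simp, by simp, by simp⟩
  apply borel_ext <;> simp [hD]

theorem maxCompact_mul_scalars : maxCompact p * scalars p = compactCenter p := by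
  ext g
  constructor
  · rintro ⟨k, ⟨h1, h2, h3⟩, z, ⟨h4, h5⟩, rfl⟩
    change _ ∧ _
    simp only [entryA_mul, entryB_mul, entryD_mul, norm_mul, h1, h3, h4, h5, mul_zero, zero_add,
      one_mul, true_and]
    exact mul_le_of_le_one_left (norm_nonneg _) h2
  · rintro ⟨h1, h2⟩
    obtain ⟨k, z, hz, rfl, hA, hB, hD⟩ := exists_mul_scalar g
    have hd := norm_pos_iff.mpr (entryD_ne_zero (k * z))
    refine ⟨k, ⟨?_, ?_, by simp [hD]⟩, z, hz, rfl⟩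
    · rw [hA, norm_div, h1, div_self hd.ne']
    · rw [hB, norm_div]; exact div_le_one_of_le₀ h2 hd.le

theorem mem_borelPlus_mul_scalars {g : Borel p} : g ∈ borelPlus p * scalars p ↔
    ‖entryA g‖ ≤ ‖entryD g‖ ∧ ‖entryB g‖ ≤ ‖entryD g‖ := by
  constructor
  · rintro ⟨k, ⟨h1, h2, h3⟩, z, ⟨h4, h5⟩, rfl⟩
    simp only [entryA_mul, entryB_mul, entryD_mul, norm_mul, h3, h4, h5, mul_zero, zero_add,
      one_mul]
    exact ⟨mul_le_of_le_one_left (norm_nonneg _) h1, mul_le_of_le_one_left (norm_nonneg _) h2⟩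
  · rintro ⟨h1, h2⟩
    obtain ⟨k, z, hz, rfl, hA, hB, hD⟩ := exists_mul_scalar g
    have hd := norm_pos_iff.mpr (entryD_ne_zero (k * z))
    refine ⟨k, ⟨?_, ?_, by simp [hD]⟩, z, hz, rfl⟩
    · rw [hA, norm_div]; exact div_le_one_of_le₀ h1 hd.le
    · rw [hB, norm_div]; exact div_le_one_of_le₀ h2 hd.le

/-- Makes `B / KZ` discrete, whence compact support modulo the centre means finitely many cosets. -/
theorem isOpen_compactCenter : IsOpen (compactCenter p : Set (Borel p)) := by
  have h : (compactCenter p : Set (Borel p)) =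
      (fun g => entryA g / entryD g) ⁻¹' Metric.sphere 0 1 ∩
      (fun g => entryB g / entryD g) ⁻¹' Metric.closedBall 0 1 := by
    ext g
    have hd := norm_pos_iff.mpr (entryD_ne_zero g)
    simp [mem_compactCenter, div_eq_one_iff_eq hd.ne', div_le_one hd]
  rw [h]
  exact ((IsUltrametricDist.isOpen_sphere 0 one_ne_zero).preimage
    (continuous_entryA.div continuous_entryD entryD_ne_zero)).inter
    ((IsUltrametricDist.isOpen_closedBall 0 one_ne_zero).preimage
    (continuous_entryB.div continuous_entryD entryD_ne_zero))

/-- Needed for [1] to have compact support modulo the centre. -/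
theorem isCompact_maxCompact : IsCompact (maxCompact p) := by
  let φ : (ℤ_[p]ˣ × ℤ_[p]ˣ) × ℤ_[p] → Borel p := fun x =>
    borelMk (Units.map (PadicInt.Coe.ringHom (p := p) : ℤ_[p] →* ℚ_[p]) x.1.1)
      (Units.map (PadicInt.Coe.ringHom (p := p) : ℤ_[p] →* ℚ_[p]) x.1.2) x.2
  have hc : Continuous (Units.map (PadicInt.Coe.ringHom (p := p) : ℤ_[p] →* ℚ_[p])) :=
    Continuous.units_map _ continuous_subtype_val
  have hφ : Continuous φ := continuous_borelMk.comp
    (((hc.comp continuous_fst).prodMap (hc.comp continuous_snd) |>.comp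
      (f := fun x : (ℤ_[p]ˣ × ℤ_[p]ˣ) × ℤ_[p] => ((x.1, x.1)))
      (by fun_prop)).prodMk (continuous_subtype_val.comp continuous_snd))
  convert isCompact_range hφ
  ext g
  constructor
  · rintro ⟨h1, h2, h3⟩
    refine ⟨((PadicInt.mkUnits h1, PadicInt.mkUnits h3), ⟨entryB g, h2⟩), ?_⟩
    apply borel_ext
    · exact entryA_borelMk _ _ _
    · exact entryB_borelMk _ _ _
    · exact entryD_borelMk _ _ _
  · rintro ⟨⟨⟨a, d⟩, b⟩, rfl⟩
    have h : ∀ u : ℤ_[p]ˣ, ‖((u : ℤ_[p]) : ℚ_[p])‖ = 1 := fun u => PadicInt.norm_units u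
    exact ⟨(congrArg norm (entryA_borelMk _ _ _)).trans (h a),
      (congrArg norm (entryB_borelMk _ _ _)).trans_le b.norm_le_one,
      (congrArg norm (entryD_borelMk _ _ _)).trans (h d)⟩

variable (p) in
/-- The unit `p` of `ℚ_p`. -/
def unitP : ℚ_[p]ˣ := Units.mk0 p (by exact_mod_cast (Fact.out : p.Prime).ne_zero)

variable (p) in
/-- The matrix `(p 0; 0 1)`. -/
def diagP : Borel p := borelMk (unitP p) 1 0

@[simp] theorem entryA_diagP_pow (n : ℕ) : entryA (diagP p ^ n) = (p : ℚ_[p]) ^ n := by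
  induction n with
  | zero => simp
  | succ n ih => simp [pow_succ, ih]; simp [diagP, unitP]

@[simp] theorem entryB_diagP_pow (n : ℕ) : entryB (diagP p ^ n) = 0 := by
  induction n with
  | zero => simp
  | succ n ih => simp [pow_succ, ih]; simp [diagP, unitP]

@[simp] theorem entryD_diagP_pow (n : ℕ) : entryD (diagP p ^ n) = 1 := by
  induction n with
  | zero => simp
  | succ n ih => simp [pow_succ, ih]; simp [diagP, unitP]

theorem diagP_mul_unip : diagP p * unip p = unip p ^ p * diagP p := by
  apply borel_ext <;> simp [entryA_unip_pow, entryB_unip_pow, entryD_unip_pow]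
  simp [diagP, unitP]

theorem unip_mem_compactCenter : unip p ∈ compactCenter p := by simp [mem_compactCenter]

/-- After scaling the lower right entry to 1, `n` is the valuation of the upper left entry. The
upper right entry matters only modulo `p ^ n`, so it can be replaced by a natural number `b`. -/
theorem exists_eq_unip_pow_mul {g : Borel p} (hg : g ∈ borelPlus p * scalars p) :
    ∃ b n : ℕ, ∃ w ∈ compactCenter p, g = unip p ^ b * diagP p ^ n * w := by
  obtain ⟨h1, h2⟩ := mem_borelPlus_mul_scalars.mp hg
  have hA := entryA_ne_zero g
  have hD := entryD_ne_zero g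
  have hd := norm_pos_iff.mpr hD
  have hpr : (1 : ℝ) < p := by exact_mod_cast (Fact.out : p.Prime).one_lt
  obtain ⟨n, hn⟩ : ∃ n : ℕ, ‖entryA g / entryD g‖ = (p : ℝ) ^ (-n : ℤ) := by
    have h3 := Padic.norm_eq_zpow_neg_valuation (div_ne_zero hA hD)
    have h4 : ‖entryA g / entryD g‖ ≤ 1 := by rw [norm_div]; exact div_le_one_of_le₀ h1 hd.le
    rw [h3, zpow_le_one_iff_right₀ hpr, neg_nonpos] at h4
    exact ⟨(entryA g / entryD g).valuation.toNat, by rw [Int.toNat_of_nonneg h4, h3]⟩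
  have hB : ‖entryB g / entryD g‖ ≤ 1 := by rw [norm_div]; exact div_le_one_of_le₀ h2 hd.le
  set x : ℤ_[p] := ⟨entryB g / entryD g, hB⟩
  -- A natural number congruent to `x` modulo `p ^ n`.
  set b := x.appr n
  have hb : ‖entryB g / entryD g - (b : ℚ_[p])‖ ≤ (p : ℝ) ^ (-n : ℤ) :=
    ((x - b).norm_le_pow_iff_mem_span_pow n).mpr (x.appr_spec n)
  have hpn : ‖(p : ℚ_[p]) ^ n‖ = (p : ℝ) ^ (-n : ℤ) := by simp
  have hpn0 : 0 < (p : ℝ) ^ (-n : ℤ) := by positivity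
  set w := (unip p ^ b * diagP p ^ n)⁻¹ * g with hw
  have hgw : g = unip p ^ b * diagP p ^ n * w := by rw [hw, mul_inv_cancel_left]
  have eA := congrArg entryA hgw
  have eB := congrArg entryB hgw
  have eD := congrArg entryD hgw
  simp only [entryA_mul, entryB_mul, entryD_mul, entryA_unip_pow, entryB_unip_pow,
    entryD_unip_pow, entryA_diagP_pow, entryB_diagP_pow, entryD_diagP_pow, one_mul, mul_one,
    zero_add] at eA eB eD
  refine ⟨b, n, w, ⟨?_, ?_⟩, hgw⟩
  · rw [norm_div, div_eq_iff hd.ne', eA, norm_mul, hpn, eD] at hn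
    exact mul_left_cancel₀ hpn0.ne' hn
  · have h5 : entryB g / entryD g - (b : ℚ_[p]) = (p : ℚ_[p]) ^ n * entryB w / entryD g := by
      field_simp
      rw [eB, eD]; ring
    rw [h5, norm_div, norm_mul, hpn, div_le_iff₀ hd, eD] at hb
    exact le_of_mul_le_mul_left hb hpn0

/-- Left multiplication by diag(p^n, 1) scales the top row by p^n and keeps the lower right entry.
-/
theorem exists_diagP_pow_mul_mem (g : Borel p) :
    ∃ m, ∀ n ≥ m, diagP p ^ n * g ∈ borelPlus p * scalars p := by
  have hd := norm_pos_iff.mpr (entryD_ne_zero g)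
  have ha := norm_pos_iff.mpr (entryA_ne_zero g)
  have hlt : ‖(p : ℚ_[p])‖ < 1 := Padic.norm_p_lt_one
  set M := max ‖entryA g‖ ‖entryB g‖
  have hM : 0 < M := lt_max_of_lt_left ha
  obtain ⟨m, hm⟩ := exists_pow_lt_of_lt_one (div_pos hd hM) hlt
  refine ⟨m, fun n hn => mem_borelPlus_mul_scalars.mpr ?_⟩
  have h : ‖(p : ℚ_[p])‖ ^ n * M ≤ ‖entryD g‖ :=
    (le_div_iff₀ hM).mp ((pow_le_pow_of_le_one (norm_nonneg _) hlt.le hn).trans hm.le)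
  simp only [entryA_mul, entryB_mul, entryD_mul, entryA_diagP_pow, entryB_diagP_pow,
    entryD_diagP_pow, zero_mul, add_zero, one_mul, norm_mul, norm_pow]
  constructor
  · exact (mul_le_mul_of_nonneg_left (le_max_left _ _) (by positivity)).trans h
  · exact (mul_le_mul_of_nonneg_left (le_max_right _ _) (by positivity)).trans h

end Cosets


/-! ### The induced representation and its augmentation onto `E(σ)` -/

section Augmentation

variable {p : ℕ} [Fact p.Prime] {E : Type*} [Field E] {σ : Borel p →* Eˣ}

theorem ind_mul_left (f : ind σ) {k : Borel p} (hk : k ∈ compactCenter p) (g : Borel p) :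
    (f : Borel p → E) (k * g) = (σ k : E) * (f : Borel p → E) g :=
  f.2.1 k (by rw [maxCompact_mul_scalars]; exact hk) g

open Classical in
/-- The function `[1]`, equal to `σ` on `KZ` and to zero elsewhere. -/
def basicFun (σ : Borel p →* Eˣ) : ind σ :=
  ⟨fun g => if g ∈ compactCenter p then (σ g : E) else 0, by
    intro k hk g
    rw [maxCompact_mul_scalars] at hk
    simp only [(compactCenter p).mul_mem_cancel_left hk, map_mul, Units.val_mul, mul_ite, mul_zero],
    maxCompact p, isCompact_maxCompact, by
    rw [maxCompact_mul_scalars]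
    intro g hg
    by_contra h
    exact hg (if_neg h)⟩

theorem basicFun_of_mem {g : Borel p} (hg : g ∈ compactCenter p) :
    (basicFun σ : Borel p → E) g = σ g := if_pos hg

theorem basicFun_of_notMem {g : Borel p} (hg : g ∉ compactCenter p) :
    (basicFun σ : Borel p → E) g = 0 := if_neg hg

theorem indRep_basicFun {w : Borel p} (hw : w ∈ compactCenter p) :
    indRep σ w (basicFun σ) = (σ w : E) • basicFun σ := by
  refine Subtype.ext (funext fun h => ?_)
  rw [indRep_apply]
  change _ = (σ w : E) * (basicFun σ : Borel p → E) h
  by_cases hh : h ∈ compactCenter p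
  · rw [basicFun_of_mem hh, basicFun_of_mem (mul_mem hh hw), map_mul, Units.val_mul, mul_comm]
  · rw [basicFun_of_notMem hh, basicFun_of_notMem, mul_zero]
    rwa [(compactCenter p).mul_mem_cancel_right hw]

/-- The function `g ↦ f (g⁻¹) σ g` on `B / KZ`. -/
def cosetFun (f : ind σ) : Borel p ⧸ compactCenter p → E :=
  Quotient.lift (fun g => (f : Borel p → E) g⁻¹ * σ g) (by
    intro g h hgh
    obtain ⟨w, hw, rfl⟩ : ∃ w ∈ compactCenter p, h = g * w :=
      ⟨g⁻¹ * h, QuotientGroup.leftRel_apply.mp hgh, by group⟩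
    simp only [mul_inv_rev]
    rw [ind_mul_left f (inv_mem hw), map_mul, map_inv]
    simp
    field_simp)

@[simp] theorem cosetFun_mk (f : ind σ) (g : Borel p) :
    cosetFun f (g : Borel p ⧸ compactCenter p) = (f : Borel p → E) g⁻¹ * σ g := rfl

theorem cosetFun_ne_zero {f : ind σ} {g : Borel p} :
    cosetFun f (g : Borel p ⧸ compactCenter p) ≠ 0 ↔ (f : Borel p → E) g⁻¹ ≠ 0 := by simp

/-- The support lies in the image of a compact set in the discrete space `B / KZ`; the central
factor is absorbed by `KZ`. -/
theorem finite_support_cosetFun (f : ind σ) : (Function.support (cosetFun f)).Finite := by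
  obtain ⟨C, hC, hfC⟩ := f.2.2
  have : DiscreteTopology (Borel p ⧸ compactCenter p) :=
    QuotientGroup.discreteTopology isOpen_compactCenter
  refine ((hC.inv.image (QuotientGroup.continuous_mk
    (N := compactCenter p))).finite_of_discrete).subset ?_
  intro x hx
  induction x using QuotientGroup.induction_on with
  | H g =>
    obtain ⟨c, hc, z, hz, hcz⟩ := hfC (cosetFun_ne_zero.mp hx)
    refine ⟨c⁻¹, by simpa using hc, QuotientGroup.eq.mpr ?_⟩
    have hg : g = z⁻¹ * c⁻¹ := by rw [← mul_inv_rev]; exact eq_inv_of_mul_eq_one_right (by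
      rw [show c * z = g⁻¹ from hcz, inv_mul_cancel])
    have hz' : z ∈ compactCenter p := mem_compactCenter.mpr ⟨by rw [hz.1], by simp [hz.2]⟩
    have hzc : z⁻¹ * c⁻¹ = c⁻¹ * z⁻¹ := by rw [← mul_inv_rev, ← mul_inv_rev, scalars_comm hz]
    rw [hg, hzc, inv_mul_cancel_left]
    exact inv_mem hz'

/-- The translates of [1] have disjoint supports: at `h` only the coset of `h⁻¹` contributes. -/
theorem eq_sum_cosetFun (f : ind σ) : f = ∑ x ∈ (finite_support_cosetFun f).toFinset,
    (f : Borel p → E) x.out⁻¹ • indRep σ x.out (basicFun σ) := by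
  refine Subtype.ext (funext fun h => ?_)
  rw [Submodule.coe_sum, Finset.sum_apply]
  simp only [Submodule.coe_smul, Pi.smul_apply, indRep_apply, smul_eq_mul]
  set y : Borel p ⧸ compactCenter p := ((h⁻¹ : Borel p) : Borel p ⧸ compactCenter p) with hy
  have hmem : h * y.out ∈ compactCenter p := by
    have h1 := QuotientGroup.eq.mp (hy.symm.trans (QuotientGroup.out_eq' y).symm)
    simpa using h1
  rw [Finset.sum_eq_single y]
  · rw [basicFun_of_mem hmem, mul_comm, ← ind_mul_left f hmem, mul_inv_cancel_right]
  · intro x _ hxy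
    rw [basicFun_of_notMem, mul_zero]
    intro hx
    apply hxy
    rw [hy, ← QuotientGroup.out_eq' x]
    exact (QuotientGroup.eq.mpr (by simpa using hx)).symm
  · intro h0
    rw [Set.Finite.mem_toFinset, Function.notMem_support, ← QuotientGroup.out_eq' y,
      cosetFun_mk, mul_eq_zero, or_iff_left (Units.ne_zero _)] at h0
    rw [h0, zero_mul]

/-- The linear form `f ↦ ∑ f (g⁻¹) σ g`, the sum being over `g` in `B / KZ`. -/
def augmentationLinear (σ : Borel p →* Eˣ) : ind σ →ₗ[E] E where
  toFun f := ∑ᶠ x, cosetFun f x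
  map_add' f g := by
    rw [← finsum_add_distrib (finite_support_cosetFun f) (finite_support_cosetFun g)]
    refine finsum_congr fun x => ?_
    induction x using QuotientGroup.induction_on with
    | H a => simp [add_mul]
  map_smul' c f := by
    rw [RingHom.id_apply, smul_finsum]
    refine finsum_congr fun x => ?_
    induction x using QuotientGroup.induction_on with
    | H a => simp [mul_assoc]

/-- The equivariant map from `ind_{KZ}^B σ` to `E(σ)` that takes `[1]` to `1`. -/
def augmentation (σ : Borel p →* Eˣ) : (indRep σ).IntertwiningMap (charRep σ) :=
  LinearMap.intertwiningMap_of_isIntertwiningMap (indRep σ) (charRep σ) (augmentationLinear σ) (by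
    intro g f
    change ∑ᶠ x, cosetFun (indRep σ g f) x = (σ g : E) * ∑ᶠ x, cosetFun f x
    -- Equivariance is a reindexing of the sum by translation by `g⁻¹` on `B / KZ`.
    rw [← smul_eq_mul, smul_finsum,
      ← finsum_comp_equiv (MulAction.toPerm g⁻¹ : Equiv.Perm (Borel p ⧸ compactCenter p))
        (f := fun x => (σ g : E) • cosetFun f x)]
    refine finsum_congr fun x => ?_
    induction x using QuotientGroup.induction_on with
    | H a =>
      change (f : Borel p → E) (a⁻¹ * g) * σ a =
        σ g * ((f : Borel p → E) (g⁻¹ * a)⁻¹ * σ (g⁻¹ * a))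
      rw [mul_inv_rev, inv_inv, map_mul, map_inv]
      simp
      field_simp)

theorem augmentation_apply (f : ind σ) : augmentation σ f =
    ∑ x ∈ (finite_support_cosetFun f).toFinset, (f : Borel p → E) x.out⁻¹ * σ x.out := by
  change ∑ᶠ x, cosetFun f x = _
  rw [finsum_eq_sum _ (finite_support_cosetFun f)]
  refine Finset.sum_congr rfl fun x _ => ?_
  conv_lhs => rw [← QuotientGroup.out_eq' x, cosetFun_mk]

theorem augmentation_basicFun : augmentation σ (basicFun σ) = 1 := by
  change ∑ᶠ x, cosetFun (basicFun σ) x = 1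
  rw [finsum_eq_single _ ((1 : Borel p) : Borel p ⧸ compactCenter p)]
  · rw [cosetFun_mk, inv_one, basicFun_of_mem (one_mem _)]
    simp
  · intro x hx
    induction x using QuotientGroup.induction_on with
    | H a =>
      rw [cosetFun_mk, basicFun_of_notMem, zero_mul]
      intro ha
      exact hx (QuotientGroup.eq.mpr (by simpa using ha))

variable {V : Type*} [AddCommGroup V] [Module E V] {ρ : Representation E (Borel p) V}

/-- If `E(σ)` is not a quotient of `Π`, then the augmentation does not vanish on the kernel of
`ind_{KZ}^B σ → Π`. -/
theorem exists_augmentation_ne_zero (q : (indRep σ).IntertwiningMap ρ)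
    (hq : Function.Surjective q)
    (hρ : ∀ s : ρ.IntertwiningMap (charRep σ), ¬ Function.Surjective s) :
    ∃ f, q f = 0 ∧ augmentation σ f ≠ 0 := by
  by_contra! hcon
  have hker : LinearMap.ker q.toLinearMap ≤ LinearMap.ker (augmentation σ).toLinearMap := hcon
  -- Otherwise the augmentation descends to `Π`; it is onto because [1] maps to 1, contradicting
  -- `hρ`.
  let s₀ : V →ₗ[E] E := (q.toLinearMap.ker.liftQ _ hker) ∘ₗ
    (q.toLinearMap.quotKerEquivOfSurjective hq).symm.toLinearMap
  have hs₀ : ∀ f, s₀ (q f) = augmentation σ f := by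
    intro f
    have : (q.toLinearMap.quotKerEquivOfSurjective hq).symm (q f) = Submodule.Quotient.mk f := by
      rw [LinearEquiv.symm_apply_eq]; rfl
    simp only [s₀, LinearMap.comp_apply, LinearEquiv.coe_coe, this]
    rfl
  refine hρ (LinearMap.intertwiningMap_of_isIntertwiningMap ρ (charRep σ) s₀ fun g v => ?_) fun c => ?_
  · obtain ⟨f, rfl⟩ := hq v
    rw [← q.isIntertwining, hs₀, hs₀, (augmentation σ).isIntertwining]
  · refine ⟨q (c • basicFun σ), ?_⟩
    change s₀ (q (c • basicFun σ)) = c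
    rw [hs₀, map_smul, augmentation_basicFun, smul_eq_mul, mul_one]

end Augmentation

/-! ### Admissibility of `Π⁺` -/

section Main

variable {p : ℕ} [Fact p.Prime] {E : Type*} [Field E] {σ : Borel p →* Eˣ}
  {V : Type*} [AddCommGroup V] [Module E V] {ρ : Representation E (Borel p) V}

theorem map_basicFun_eq (q : (indRep σ).IntertwiningMap ρ) {b n : ℕ} {w : Borel p}
    (hw : w ∈ compactCenter p) :
    ρ (unip p ^ b * diagP p ^ n * w) (q (basicFun σ)) =
      (σ w : E) • (ρ (unip p) ^ b) ((ρ (diagP p) ^ n) (q (basicFun σ))) := by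
  rw [map_mul, map_mul, map_pow, map_pow, Module.End.mul_apply, Module.End.mul_apply,
    ← q.isIntertwining, indRep_basicFun hw, map_smul, map_smul, map_smul]

/-- A positive function is a combination of translates of [1] by elements of `B⁺Z`, each of which is
u^b diag(p^n, 1) times an element of `KZ` acting on [1] by a scalar. -/
theorem piPlus_le (q : (indRep σ).IntertwiningMap ρ) :
    piPlus q ≤ ⨆ k, levelSpan (ρ (unip p)) (ρ (diagP p)) (q (basicFun σ)) k := by
  rintro _ ⟨f, hf, rfl⟩
  change q f ∈ _
  rw [eq_sum_cosetFun f, map_sum]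
  refine Submodule.sum_mem _ fun x hx => ?_
  rw [Set.Finite.mem_toFinset, Function.mem_support, ← QuotientGroup.out_eq' x,
    cosetFun_ne_zero] at hx
  have hg := hf _ hx
  rw [inv_inv] at hg
  obtain ⟨b, n, w, hw, hx'⟩ := exists_eq_unip_pow_mul hg
  rw [map_smul, q.isIntertwining, hx', map_basicFun_eq q hw]
  exact Submodule.smul_mem _ _ (Submodule.smul_mem _ _
    (Submodule.mem_iSup_of_mem n (mem_levelSpan le_rfl)))

theorem finiteDimensional_ker_inf_piPlus (hσ : σ (unip p) = 1)
    (q : (indRep σ).IntertwiningMap ρ) (hq : Function.Surjective q)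
    (hρ : ∀ s : ρ.IntertwiningMap (charRep σ), ¬ Function.Surjective s) :
    FiniteDimensional E (LinearMap.ker (ρ (unip p) - 1) ⊓ piPlus q : Submodule E V) := by
  obtain ⟨f, hf0, hf⟩ := exists_augmentation_ne_zero q hq hρ
  set s := (finite_support_cosetFun f).toFinset
  choose m hm using fun x : Borel p ⧸ compactCenter p => exists_diagP_pow_mul_mem x.out
  -- One power of diag(p, 1) that brings all the finitely many cosets supporting `f` into `B⁺Z`.
  set k := s.sup m
  have hmem : ∀ x : s, diagP p ^ k * x.1.out ∈ borelPlus p * scalars p :=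
    fun x => hm x.1 k (Finset.le_sup x.2)
  choose b n w hw hbnw using fun x : s => exists_eq_unip_pow_mul (hmem x)
  set v := q (basicFun σ)
  have hU : ρ (unip p) v = v := by
    rw [← q.isIntertwining, indRep_basicFun unip_mem_compactCenter, hσ, Units.val_one, one_smul]
  have hFU : ρ (diagP p) * ρ (unip p) = ρ (unip p) ^ p * ρ (diagP p) := by
    rw [← map_mul, diagP_mul_unip, map_mul, map_pow]
  have hfin := finiteDimensional_ker_inf_iSup_levelSpan (Fact.out : p.Prime).pos hFU hU
    (Finset.univ : Finset s) (fun x => (f : Borel p → E) x.1.out⁻¹ * σ (w x)) b n ?_ ?_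
  · exact Submodule.finiteDimensional_of_le (inf_le_inf_left _ (piPlus_le q))
  · have h1 : ρ (diagP p ^ k) (q f) = 0 := by rw [hf0, map_zero]
    rw [eq_sum_cosetFun f, map_sum, map_sum, ← Finset.sum_coe_sort] at h1
    rw [← h1]
    refine Finset.sum_congr rfl fun x _ => ?_
    rw [map_smul, map_smul, q.isIntertwining, ← Module.End.mul_apply (ρ _), ← map_mul, hbnw x,
      map_basicFun_eq q (hw x), mul_smul]
  · intro h0
    apply hf
    -- Applying `σ` to `hbnw` turns `σ(diagP)^n σ(w)` into `σ(diagP)^k σ(x.out)`, so the value at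
    -- `σ(diagP)` is `σ(diagP)^k` times the augmentation of `f`, which is nonzero.
    have h1 := congrArg (Polynomial.eval (σ (diagP p) : E)) h0
    simp only [Polynomial.eval_finsetSum, Polynomial.eval_monomial, Polynomial.eval_zero] at h1
    have h2 : (σ (diagP p) : E) ^ k * augmentation σ f = 0 := by
      rw [← h1, augmentation_apply, Finset.mul_sum, ← Finset.sum_coe_sort]
      refine Finset.sum_congr rfl fun x _ => ?_
      have h3 := congrArg (fun g => (σ g : E)) (hbnw x)
      simp only [map_mul, map_pow, hσ, one_pow, one_mul, Units.val_mul, Units.val_pow_eq_pow_val]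
        at h3
      linear_combination (f : Borel p → E) x.1.out⁻¹ * h3
    exact (mul_eq_zero.mp h2).resolve_left (pow_ne_zero _ (Units.ne_zero _))

theorem tensorChar_unip (σ₁ σ₂ : ℚ_[p]ˣ →* Eˣ) : tensorChar σ₁ σ₂ (unip p) = 1 := by
  simp [tensorChar]

variable {σ₁ σ₂ : ℚ_[p]ˣ →* Eˣ} [CharP E p]

theorem X_pow_smul (q : (indRep (tensorChar σ₁ σ₂)).IntertwiningMap ρ) (n : ℕ) (v : piPlus q) :
    (PowerSeries.X ^ n : E⟦X⟧) • v = (opX q ^ n) v := by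
  induction n with
  | zero => simp
  | succ n ih =>
    rw [pow_succ', pow_succ', mul_smul, ih]
    exact act_X (opX q) (locNilp_opX q) _

theorem isTorsion_piPlus (q : (indRep (tensorChar σ₁ σ₂)).IntertwiningMap ρ) :
    Module.IsTorsion E⟦X⟧ (piPlus q) := by
  intro v
  obtain ⟨n, hn⟩ := locNilp_opX q v
  exact ⟨⟨PowerSeries.X ^ n, mem_nonZeroDivisors_of_ne_zero (pow_ne_zero n PowerSeries.X_ne_zero)⟩,
    (X_pow_smul q n v).trans hn⟩

end Main

end BorelRep

end

theorem mainTheorem4 (p : ℕ) [Fact p.Prime] (E : Type*) [Field E] [CharP E p]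
    (σ₁ σ₂ : ℚ_[p]ˣ →* Eˣ)
    (hσ₁ : IsOpen (σ₁.ker : Set ℚ_[p]ˣ)) (hσ₂ : IsOpen (σ₂.ker : Set ℚ_[p]ˣ))
    (V : Type*) [AddCommGroup V] [Module E V] (ρ : Representation E (BorelRep.Borel p) V)
    (q : (BorelRep.indRep (BorelRep.tensorChar σ₁ σ₂)).IntertwiningMap ρ)
    (hq : Function.Surjective q)
    (hρ : ∀ s : ρ.IntertwiningMap (BorelRep.charRep (BorelRep.tensorChar σ₁ σ₂)),
      ¬ Function.Surjective s) :
    BorelRep.IsAdmissible E (BorelRep.piPlus q) := by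
  refine ⟨BorelRep.isTorsion_piPlus q, ?_⟩
  have := BorelRep.finiteDimensional_ker_inf_piPlus (BorelRep.tensorChar_unip σ₁ σ₂) q hq hρ
  -- The `X`-torsion of `Π⁺` embeds in the kernel of `U - 1` computed inside `V`.
  let φ : Submodule.torsionBy (PowerSeries E) (BorelRep.piPlus q) (PowerSeries.X : PowerSeries E)
      →ₗ[E] (LinearMap.ker (ρ (BorelRep.unip p) - 1) ⊓ BorelRep.piPlus q : Submodule E V) :=
    { toFun := fun v => ⟨v.1.1, by
        have h1 := BorelRep.piPlus_X_smul q v.1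
        rw [(Submodule.mem_torsionBy_iff _ _).mp v.2] at h1
        exact h1.symm, v.1.2⟩
      map_add' := fun _ _ => rfl
      map_smul' := fun _ _ => rfl }
  refine FiniteDimensional.of_injective φ fun v w h => Subtype.ext (Subtype.ext ?_)
  have h' := congrArg Subtype.val h
  exact h'
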